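/- Let $\mathcal H$ be a complex Hilbert space with inner product antilinear in the first entry. A (linear) relation is a linear subset $T\subset\mathcal H\oplus\mathcal H$; its adjoint is $T^*=\{(h,k):\langle k,f\rangle=\langle h,g\rangle\ \forall (f,g)\in T\}$, and $T$ is selfadjoint if $T=T^*$. Write $T-\zeta I=\{(f,g-\zeta f):(f,g)\in T\}$, $T^{-1}=\{(g,f):(f,g)\in T\}$ and $N_\zeta(T)=\{(f,g)\in T: g=\zeta f\}$. A relation $T$ is bounded if for some $C>0$ one has $\|g\|\le C\|f\|$ for all $(f,g)\in T$; $\hat\rho(T)$ is the set of $\zeta\in\mathbb C$ such that $(T-\zeta I)^{-1}$ is bounded, and $\sigma(T)$ is the complement in $\mathbb C$ of the set of $\zeta$ such that $(T-\zeta I)^{-1}$ is bounded with domain $\mathcal H$. The multiplicity of $\zeta$ as an eigenvalue of $T$ is $\dim\ker(T-\zeta I)$ (multiplicity $0$ means that $\zeta$ is not an eigenvalue), and the essential spectrum $\sigma_e(T)$ is the set of $\zeta\in\mathbb C$ such that $\ker(T-\zeta I)$ is infinite-dimensional or $\operatorname{ran}(T-\zeta I)$ is not closed. $T$ is quasi-null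 if $\langle f,g\rangle=0$ for all $(f,g)\in T$, lower semi-bounded if there is $m\in\mathbb R$ with $\langle f,g\rangle\in\mathbb R$ and $\langle f,g\rangle\ge m\|f\|^2$ for all $(f,g)\in T$, and upper semi-bounded if $-T=\{(f,-g):(f,g)\in T\}$ is lower semi-bounded. Let $A$ be a closed quasi-null relation with finite index $\eta_A=\dim N_\zeta(A^*)<\infty$, where $\zeta\in\hat\rho(A)$ is any point (the dimension does not depend on it). For $\alpha\in\mathbb R\setminus\{0\}$ put $S_\alpha=A+N_\alpha(A^*)$. Then, for every $\alpha\in\mathbb R\setminus\{0\}$: 1. the sum $S_\alpha=A\dotplus N_\alpha(A^*)$ is direct, and $S_\alpha$ is the one and only selfadjoint extension of $A$ that has $\alpha$ as an eigenvalue of multiplicity $\eta_A$; 2. every nonzero $\zeta\in\sigma(S_\alpha)$ is an isolated point of $\sigma(S_\alpha)$ and an eigenvalue of $S_\alpha$ of multiplicity at most $\eta_A$, and $\sigma_e(S_\alpha)\subset\{0\}$; 3. $S_\alpha$ is lower semi-bounded if $\alpha<0$ and upper semi-bounded if $\alpha>0$. Moreover, $\sigma_e(S_\alpha)=\sigma_e(S_\beta)$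 for all $\alpha,\beta\in\mathbb R\setminus\{0\}$. -/

import Mathlib

/-! Linear relations in a complex Hilbert space `H`: linear subsets of `H × H`, i.e. elements of
`Submodule ℂ (H × H)`. The inner product is antilinear in its first entry. The adjoint of a relation
is Mathlib's `Submodule.adjoint`. -/

namespace LinRel

variable {H : Type*} [NormedAddCommGroup H] [InnerProductSpace ℂ H]

/-- The domain of a relation. -/
def dom (T : Submodule ℂ (H × H)) : Submodule ℂ H := T.map (LinearMap.fst ℂ H H)

/-- The range of a relation. -/
def ran (T : Submodule ℂ (H × H)) : Submodule ℂ H := T.map (LinearMap.snd ℂ H H)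

/-- The kernel `{f | (f, 0) ∈ T}` of a relation. -/
def ker (T : Submodule ℂ (H × H)) : Submodule ℂ H := T.comap (LinearMap.inl ℂ H H)

/-- The inverse relation `{(g, f) | (f, g) ∈ T}`. -/
def inv (T : Submodule ℂ (H × H)) : Submodule ℂ (H × H) where
  carrier := {p | (p.2, p.1) ∈ T}
  add_mem' hp hq := T.add_mem hp hq
  zero_mem' := T.zero_mem
  smul_mem' c _ hp := T.smul_mem c hp

/-- The relation `-T = {(f, -g) | (f, g) ∈ T}`. -/
def neg (T : Submodule ℂ (H × H)) : Submodule ℂ (H × H) where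
  carrier := {p | ∃ f g : H, (f, g) ∈ T ∧ p = (f, -g)}
  add_mem' := by
    rintro _ _ ⟨f, g, h, rfl⟩ ⟨f', g', h', rfl⟩
    exact ⟨f + f', g + g', T.add_mem h h', by simp [add_comm]⟩
  zero_mem' := ⟨0, 0, T.zero_mem, by simp [Prod.ext_iff]⟩
  smul_mem' := by
    rintro c _ ⟨f, g, h, rfl⟩
    exact ⟨c • f, c • g, T.smul_mem c h, by simp⟩

/-- The relation `T - ζ I = {(f, g - ζ f) | (f, g) ∈ T}`. -/
def subScalar (T : Submodule ℂ (H × H)) (ζ : ℂ) : Submodule ℂ (H × H) where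
  carrier := {p | ∃ f g : H, (f, g) ∈ T ∧ p = (f, g - ζ • f)}
  add_mem' := by
    rintro _ _ ⟨f, g, h, rfl⟩ ⟨f', g', h', rfl⟩
    exact ⟨f + f', g + g', T.add_mem h h', by
      simp only [Prod.mk_add_mk, smul_add, Prod.mk.injEq, true_and]; abel⟩
  zero_mem' := ⟨0, 0, T.zero_mem, by simp [Prod.ext_iff]⟩
  smul_mem' := by
    rintro c _ ⟨f, g, h, rfl⟩
    exact ⟨c • f, c • g, T.smul_mem c h, by simp [smul_sub, smul_comm c ζ f]⟩

/-- `T` is bounded: `‖g‖ ≤ C ‖f‖` on `T` for some `C > 0` (so `T` is an operator). -/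
def IsBounded (T : Submodule ℂ (H × H)) : Prop :=
  ∃ C : ℝ, 0 < C ∧ ∀ f g : H, (f, g) ∈ T → ‖g‖ ≤ C * ‖f‖

/-- The quasi-regular set: `(T - ζ I)⁻¹` is bounded. -/
def quasiRegularSet (T : Submodule ℂ (H × H)) : Set ℂ :=
  {ζ | IsBounded (inv (subScalar T ζ))}

/-- The regular set: `(T - ζ I)⁻¹` is a bounded operator defined on the whole space. -/
def regularSet (T : Submodule ℂ (H × H)) : Set ℂ :=
  {ζ | IsBounded (inv (subScalar T ζ)) ∧ dom (inv (subScalar T ζ)) = ⊤}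

/-- The spectrum `σ(T)`. -/
def spec (T : Submodule ℂ (H × H)) : Set ℂ := (regularSet T)ᶜ

/-- The eigenspace `ker (T - ζ I)`; its dimension is the multiplicity of `ζ`. -/
def eigenspace (T : Submodule ℂ (H × H)) (ζ : ℂ) : Submodule ℂ H := ker (subScalar T ζ)

/-- The point spectrum `σ_p(T)`, the set of eigenvalues. -/
def pointSpectrum (T : Submodule ℂ (H × H)) : Set ℂ := {ζ | eigenspace T ζ ≠ ⊥}

/-- The eigenvalues of infinite multiplicity. -/
def infinitePointSpectrum (T : Submodule ℂ (H × H)) : Set ℂ :=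
  {ζ | ζ ∈ pointSpectrum T ∧ ¬ FiniteDimensional ℂ (eigenspace T ζ)}

/-- The continuous spectrum `σ_c(T)`: the range of `T - ζ I` is not closed. -/
def continuousSpectrum (T : Submodule ℂ (H × H)) : Set ℂ :=
  {ζ | ¬ IsClosed (ran (subScalar T ζ) : Set H)}

/-- The essential spectrum. -/
def essentialSpectrum (T : Submodule ℂ (H × H)) : Set ℂ :=
  infinitePointSpectrum T ∪ continuousSpectrum T

/-- `T` is selfadjoint: `T = T*`. -/
def IsSelfadjointRel [CompleteSpace H] (T : Submodule ℂ (H × H)) : Prop := T.adjoint = T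

/-- The space `N_ζ(T) = {(f, ζ f) ∈ T}`; for `T = A*` it is the deficiency space of `A` at `ζ`. -/
def deficiencySpace (T : Submodule ℂ (H × H)) (ζ : ℂ) : Submodule ℂ (H × H) where
  carrier := {p | p ∈ T ∧ p.2 = ζ • p.1}
  add_mem' hp hq := ⟨T.add_mem hp.1 hq.1, by simp [hp.2, hq.2]⟩
  zero_mem' := ⟨T.zero_mem, by simp⟩
  smul_mem' c p hp := ⟨T.smul_mem c hp.1, by simp [hp.2, smul_comm c ζ p.1]⟩

/-- `T` is quasi-null: `⟨f, g⟩ = 0` for all `(f, g) ∈ T`. -/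
def IsQuasiNull (T : Submodule ℂ (H × H)) : Prop :=
  ∀ f g : H, (f, g) ∈ T → inner ℂ f g = 0

/-- `T` is lower semi-bounded: for some real `m`, the number `⟨f, g⟩` is real and at least
`m ‖f‖²` for all `(f, g) ∈ T`. -/
def IsLowerSemibounded (T : Submodule ℂ (H × H)) : Prop :=
  ∃ m : ℝ, ∀ f g : H, (f, g) ∈ T →
    (inner ℂ f g).im = 0 ∧ m * ‖f‖ ^ 2 ≤ (inner ℂ f g).re

/-- `T` is upper semi-bounded: `-T` is lower semi-bounded. -/
def IsUpperSemibounded (T : Submodule ℂ (H × H)) : Prop := IsLowerSemibounded (neg T)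

/-- The sum `S_α = A + N_α(A*)`; its directness is a claim of the theorem. -/
noncomputable def extensionAt [CompleteSpace H] (A : Submodule ℂ (H × H)) (α : ℂ) :
    Submodule ℂ (H × H) :=
  A ⊔ deficiencySpace A.adjoint α

end LinRel

open scoped ComplexConjugate InnerProductSpace

namespace LinRel

variable {H : Type*} [NormedAddCommGroup H] [InnerProductSpace ℂ H]

/-! ### Elementary algebra of relations -/

section Membership

variable {T : Submodule ℂ (H × H)}

/-! Polarization makes the domain and range of `A` orthogonal, so `‖g - ζ f‖² = ‖g‖² + |ζ|² ‖f‖²` on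
`A`. Every `ζ ≠ 0` is therefore quasi-regular, `A - ζ` has closed range, and `H = ran (A - ζ) ⊕ ker
(A* - conj ζ)`. Projecting one deficiency space to another shows that they all have dimension `η`
(`IsQuasiNull.rank_eigenspace_adjoint_le`).

For real `α ≠ 0` the decomposition at `α` gives selfadjointness of `S_α`
(`IsQuasiNull.isSelfadjointRel_extensionAt`). A selfadjoint extension with multiplicity `η` at `α`
contains all of `N_α(A*)`, hence `S_α`, and so equals it. The form of `S_α` at `(x, y)` is `α (‖x‖²
- ‖f‖²)`, where `f` comes from the `A`-part; this gives semi-boundedness.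

Since `S_α` is a finite-dimensional extension of `A`, closedness of ranges passes between them
(`isClosed_ran_sup_iff`). Off `0`, spectral points are thus eigenvalues, isolated by a lower bound
on the complement of the kernel (`IsSelfadjointRel.exists_le_dist`). At `0`, essential spectrum is
decided by `A` alone. -/

theorem mem_subScalar {ζ : ℂ} {f g : H} : (f, g) ∈ subScalar T ζ ↔ (f, g + ζ • f) ∈ T := by
  constructor
  · rintro ⟨f', g', h, e⟩
    obtain ⟨rfl, rfl⟩ := Prod.mk.inj e
    simpa using h
  · exact fun h ↦ ⟨f, g + ζ • f, h, by simp⟩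

theorem mem_inv {f g : H} : (f, g) ∈ inv T ↔ (g, f) ∈ T := Iff.rfl

theorem mem_ran {y : H} : y ∈ ran T ↔ ∃ f, (f, y) ∈ T := by
  simp [ran]

theorem mem_ker {f : H} : f ∈ ker T ↔ (f, (0 : H)) ∈ T := by
  simp [ker]

theorem dom_inv : dom (inv T) = ran T := by
  ext y
  simp [dom, mem_ran, mem_inv]

theorem mem_ran_subScalar {ζ : ℂ} {y : H} :
    y ∈ ran (subScalar T ζ) ↔ ∃ f g, (f, g) ∈ T ∧ y = g - ζ • f := by
  rw [mem_ran]
  constructor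
  · rintro ⟨f, h⟩
    exact ⟨f, _, mem_subScalar.1 h, by simp⟩
  · rintro ⟨f, g, h, rfl⟩
    exact ⟨f, f, g, h, rfl⟩

theorem mem_eigenspace {ζ : ℂ} {f : H} : f ∈ eigenspace T ζ ↔ (f, ζ • f) ∈ T := by
  rw [eigenspace, mem_ker, mem_subScalar, zero_add]

theorem mem_adjoint {h k : H} :
    (h, k) ∈ T.adjoint ↔ ∀ f g, (f, g) ∈ T → ⟪g, h⟫_ℂ = ⟪f, k⟫_ℂ := by
  rw [Submodule.mem_adjoint_iff]
  exact forall₃_congr fun _ _ _ ↦ sub_eq_zero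

theorem mem_quasiRegularSet {ζ : ℂ} :
    ζ ∈ quasiRegularSet T ↔
      ∃ C : ℝ, 0 < C ∧ ∀ f g, (f, g) ∈ T → ‖f‖ ≤ C * ‖g - ζ • f‖ := by
  constructor
  · rintro ⟨C, hC, h⟩
    exact ⟨C, hC, fun f g hfg ↦ h _ _ ⟨f, g, hfg, rfl⟩⟩
  · rintro ⟨C, hC, h⟩
    refine ⟨C, hC, fun g f hfg ↦ ?_⟩
    simpa using h _ _ (mem_subScalar.1 (mem_inv.1 hfg))

/-- The eigenspace at `ζ` is isomorphic to the space of pairs `(f, ζ f)` in the relation. -/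
def eigenspaceEquivDeficiencySpace (T : Submodule ℂ (H × H)) (ζ : ℂ) :
    eigenspace T ζ ≃ₗ[ℂ] deficiencySpace T ζ where
  toFun f := ⟨(f, ζ • (f : H)), mem_eigenspace.1 f.2, rfl⟩
  map_add' f g := by ext <;> simp
  map_smul' c f := by ext <;> simp [smul_comm c ζ]
  invFun p := ⟨p.1.1, by
    obtain ⟨⟨f, g⟩, h, e⟩ := p
    have e' : g = ζ • f := e
    subst e'
    exact mem_eigenspace.2 h⟩
  left_inv f := rfl
  right_inv p := by
    obtain ⟨⟨f, g⟩, h, e⟩ := p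
    have e' : g = ζ • f := e
    subst e'
    rfl

theorem rank_deficiencySpace (T : Submodule ℂ (H × H)) (ζ : ℂ) :
    Module.rank ℂ (deficiencySpace T ζ) = Module.rank ℂ (eigenspace T ζ) :=
  (eigenspaceEquivDeficiencySpace T ζ).rank_eq.symm

theorem finiteDimensional_deficiencySpace (T : Submodule ℂ (H × H)) (ζ : ℂ)
    [FiniteDimensional ℂ (eigenspace T ζ)] : FiniteDimensional ℂ (deficiencySpace T ζ) :=
  (eigenspaceEquivDeficiencySpace T ζ).finiteDimensional

theorem subScalar_eq_map (T : Submodule ℂ (H × H)) (ζ : ℂ) :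
    subScalar T ζ = T.map ((LinearMap.fst ℂ H H).prod
      (LinearMap.snd ℂ H H - ζ • LinearMap.fst ℂ H H)) := by
  ext p
  constructor
  · rintro ⟨f, g, h, rfl⟩
    exact ⟨(f, g), h, rfl⟩
  · rintro ⟨⟨f, g⟩, h, rfl⟩
    exact ⟨f, g, h, rfl⟩

theorem subScalar_sup (T N : Submodule ℂ (H × H)) (ζ : ℂ) :
    subScalar (T ⊔ N) ζ = subScalar T ζ ⊔ subScalar N ζ := by
  simp only [subScalar_eq_map, Submodule.map_sup]

theorem subScalar_zero (T : Submodule ℂ (H × H)) : subScalar T 0 = T := by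
  ext ⟨f, g⟩
  simp [mem_subScalar]

theorem mem_essentialSpectrum {ζ : ℂ} :
    ζ ∈ essentialSpectrum T ↔
      ¬ (FiniteDimensional ℂ (eigenspace T ζ) ∧ IsClosed (ran (subScalar T ζ) : Set H)) := by
  have h : ¬ FiniteDimensional ℂ (eigenspace T ζ) → ζ ∈ pointSpectrum T := fun h hbot ↦
    h (hbot ▸ inferInstance)
  rw [not_and_or]
  exact or_congr (and_iff_right_of_imp h) Iff.rfl

theorem eigenspace_mono {T' : Submodule ℂ (H × H)} (h : T ≤ T') (ζ : ℂ) :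
    eigenspace T ζ ≤ eigenspace T' ζ :=
  fun _ hf ↦ mem_eigenspace.2 (h (mem_eigenspace.1 hf))

theorem adjoint_anti {T' : Submodule ℂ (H × H)} (h : T ≤ T') : T'.adjoint ≤ T.adjoint := by
  rintro ⟨x, y⟩ hx
  exact mem_adjoint.2 fun f g hfg ↦ mem_adjoint.1 hx f g (h hfg)

theorem isClosed_adjoint (T : Submodule ℂ (H × H)) : IsClosed (T.adjoint : Set (H × H)) := by
  have : (T.adjoint : Set (H × H)) =
      ⋂ p : T, {q : H × H | ⟪p.1.2, q.1⟫_ℂ = ⟪p.1.1, q.2⟫_ℂ} := by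
    ext ⟨h, k⟩
    simp only [SetLike.mem_coe, mem_adjoint, Set.mem_iInter, Set.mem_ofPred_eq, Subtype.forall,
      Prod.forall]
  rw [this]
  exact isClosed_iInter fun p ↦ isClosed_eq (by fun_prop) (by fun_prop)

theorem isClosed_subScalar (hT : IsClosed (T : Set (H × H))) (ζ : ℂ) :
    IsClosed (subScalar T ζ : Set (H × H)) := by
  have : (subScalar T ζ : Set (H × H)) = (fun p : H × H ↦ (p.1, p.2 + ζ • p.1)) ⁻¹' T := by
    ext ⟨f, g⟩
    exact mem_subScalar
  rw [this]
  exact hT.preimage (by fun_prop)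

theorem eigenspace_adjoint (T : Submodule ℂ (H × H)) (ζ : ℂ) :
    eigenspace T.adjoint ζ = (ran (subScalar T (conj ζ)))ᗮ := by
  ext h
  rw [mem_eigenspace, mem_adjoint, Submodule.mem_orthogonal]
  constructor
  · intro hh y hy
    obtain ⟨f, g, hfg, rfl⟩ := mem_ran_subScalar.1 hy
    simp [inner_sub_left, inner_smul_left, hh f g hfg]
  · intro hh f g hfg
    have := hh _ (mem_ran_subScalar.2 ⟨f, g, hfg, rfl⟩)
    simpa [inner_sub_left, inner_smul_left, inner_smul_right, sub_eq_zero] using this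

/-- The quotient `(T + N) / T` is an image of `N`. -/
theorem cofg_comap_sup (T N : Submodule ℂ (H × H)) [FiniteDimensional ℂ N] :
    (T.comap (T ⊔ N).subtype).CoFG := by
  refine Module.Finite.of_surjective ((T.comap (T ⊔ N).subtype).mkQ ∘ₗ
    Submodule.inclusion (le_sup_right : N ≤ T ⊔ N)) fun q ↦ ?_
  obtain ⟨⟨p, hp⟩, rfl⟩ := Submodule.mkQ_surjective _ q
  obtain ⟨t, ht, n, hn, rfl⟩ := Submodule.mem_sup.1 hp
  refine ⟨⟨n, hn⟩, (Submodule.Quotient.eq _).2 ?_⟩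
  simpa using ht

/-- The map `f ↦ (f, 0)` from `ker (T + N)` to the finite-dimensional `(T + N) / T` has kernel `ker
T`. -/
theorem finiteDimensional_ker_sup_iff (N : Submodule ℂ (H × H)) [FiniteDimensional ℂ N] :
    FiniteDimensional ℂ (ker (T ⊔ N)) ↔ FiniteDimensional ℂ (ker T) := by
  have hle : ker T ≤ ker (T ⊔ N) := Submodule.comap_mono le_sup_left
  refine ⟨fun h ↦ Submodule.finiteDimensional_of_le hle, fun h ↦ ?_⟩
  have := cofg_comap_sup T N
  let v : ker (T ⊔ N) →ₗ[ℂ] (T ⊔ N : Submodule ℂ (H × H)) ⧸ T.comap (T ⊔ N).subtype :=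
    Submodule.mkQ _ ∘ₗ
      (LinearMap.inl ℂ H H ∘ₗ (ker (T ⊔ N)).subtype).codRestrict (T ⊔ N) fun f ↦ f.2
  have hv : ∀ f : LinearMap.ker v, (f.1 : H) ∈ ker T := fun f ↦
    (Submodule.Quotient.mk_eq_zero (T.comap (T ⊔ N).subtype)).1 (LinearMap.mem_ker.1 f.2)
  have : FiniteDimensional ℂ (LinearMap.ker v) :=
    FiniteDimensional.of_injective
      (((ker (T ⊔ N)).subtype ∘ₗ (LinearMap.ker v).subtype).codRestrict (ker T) hv)
      fun f g hfg ↦ Subtype.ext (Subtype.ext (congrArg (fun x : ker T ↦ (x : H)) hfg))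
  have : (LinearMap.ker v).CoFG := Submodule.CoFG.ker v
  exact Module.Finite.of_submodule_quotient (LinearMap.ker v)

end Membership

/-! ### Closed ranges and finite-dimensional extensions -/

section ClosedRange

variable [CompleteSpace H] {T : Submodule ℂ (H × H)}

theorem isClosed_ran_of_isBounded_inv (hT : IsClosed (T : Set (H × H)))
    (hb : IsBounded (inv T)) : IsClosed (ran T : Set H) := by
  obtain ⟨C, hC, h⟩ := hb
  have : CompleteSpace T := hT.completeSpace_coe
  let u : T →L[ℂ] H := (ContinuousLinearMap.snd ℂ H H).comp T.subtypeL
  -- `H × H` has the maximum norm: `C` controls the first coordinate, `1` the second.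
  have hu : AntilipschitzWith (Real.toNNReal (max C 1)) u := by
    refine u.antilipschitz_of_bound fun p ↦ ?_
    rw [Real.coe_toNNReal _ (by positivity)]
    have h1 : ‖p.1.1‖ ≤ C * ‖p.1.2‖ := h _ _ p.2
    refine max_le (h1.trans ?_) ?_
    · exact mul_le_mul_of_nonneg_right (le_max_left _ _) (norm_nonneg _)
    · exact le_mul_of_one_le_left (norm_nonneg _) (le_max_right _ _)
  convert hu.isClosed_range u.uniformContinuous
  ext y
  simp [mem_ran, u]

/-- A closed relation with closed range is bounded below on the orthogonal complement of its
kernel. -/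
theorem exists_norm_le_of_isClosed_ran (hT : IsClosed (T : Set (H × H)))
    (hr : IsClosed (ran T : Set H)) :
    ∃ C : ℝ, 0 < C ∧ ∀ f g, (f, g) ∈ T → f ∈ (ker T)ᗮ → ‖f‖ ≤ C * ‖g‖ := by
  have hk : IsClosed (ker T : Set H) :=
    hT.preimage (by fun_prop : Continuous fun f : H ↦ (f, (0 : H)))
  have : CompleteSpace (ker T) := hk.completeSpace_coe
  -- This restriction makes the second projection injective and keeps its range.
  let T' : Submodule ℂ (H × H) := T ⊓ (ker T)ᗮ.comap (LinearMap.fst ℂ H H)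
  have hT' : IsClosed (T' : Set (H × H)) :=
    hT.inter ((Submodule.isClosed_orthogonal _).preimage continuous_fst)
  have : CompleteSpace T' := hT'.completeSpace_coe
  let u : T' →L[ℂ] H := (ContinuousLinearMap.snd ℂ H H).comp T'.subtypeL
  have hinj : Function.Injective u := by
    refine (injective_iff_map_eq_zero u).2 ?_
    rintro ⟨⟨f, g⟩, h, hf⟩ (hg : g = 0)
    subst hg
    have hf0 : f = 0 := by
      have := (Submodule.mem_orthogonal _ _).1 hf f (mem_ker.2 h)
      simpa using this
    subst hf0
    rfl
  have hrange : IsClosed (Set.range u) := by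
    convert hr
    ext y
    constructor
    · rintro ⟨⟨⟨f, g⟩, h, hf⟩, rfl⟩
      exact mem_ran.2 ⟨f, h⟩
    · intro hy
      obtain ⟨f, h⟩ := mem_ran.1 hy
      obtain ⟨k, hk, z, hz, rfl⟩ := (ker T).exists_add_mem_mem_orthogonal f
      refine ⟨⟨(z, y), ?_, hz⟩, rfl⟩
      simpa using T.sub_mem h (mem_ker.1 hk)
  obtain ⟨K, hK⟩ := u.antilipschitz_of_injective_of_isClosed_range hinj hrange
  refine ⟨K + 1, by positivity, fun f g h hf ↦ ?_⟩
  have h1 : ‖(f, g)‖ ≤ K * ‖g‖ := hK.le_mul_norm (map_zero u) (⟨(f, g), h, hf⟩ : T')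
  nlinarith [norm_fst_le (f, g), norm_nonneg g]

/-- A finite-dimensional extension of a closed relation has closed range if and only if the
relation has. -/
theorem isClosed_ran_sup_iff (hT : IsClosed (T : Set (H × H))) (N : Submodule ℂ (H × H))
    [FiniteDimensional ℂ N] :
    IsClosed (ran (T ⊔ N) : Set H) ↔ IsClosed (ran T : Set H) := by
  refine ⟨fun h ↦ ?_, fun h ↦ ?_⟩
  -- The second projection on `T + N` is strict with closed range; this persists on the closed
  -- subspace `T` of finite codimension.
  · have hS := Submodule.isClosed_sup_finiteDimensional T N hT
    have : CompleteSpace (T ⊔ N : Submodule ℂ (H × H)) := hS.completeSpace_coe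
    let T' : Submodule ℂ (T ⊔ N : Submodule ℂ (H × H)) := T.comap (T ⊔ N).subtype
    have hT' : IsClosed (T' : Set (T ⊔ N : Submodule ℂ (H × H))) :=
      hT.preimage continuous_subtype_val
    have : T'.CoFG := cofg_comap_sup T N
    let u : (T ⊔ N : Submodule ℂ (H × H)) →L[ℂ] H :=
      (ContinuousLinearMap.snd ℂ H H).comp (T ⊔ N).subtypeL
    have hu : (u.range : Set H) = ran (T ⊔ N) := by
      ext y
      rw [SetLike.mem_coe, SetLike.mem_coe, mem_ran, LinearMap.mem_range]
      exact ⟨fun ⟨p, hp⟩ ↦ ⟨p.1.1, by rw [← hp]; exact p.2⟩, fun ⟨f, hf⟩ ↦ ⟨⟨(f, y), hf⟩, rfl⟩⟩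
    have huc : IsClosed (u.range : Set H) := by rwa [hu]
    have hustrict : Topology.IsStrictMap u := by
      have : CompleteSpace u.range := huc.completeSpace_coe
      exact u.rangeRestrict.isQuotientMap u.toLinearMap.surjective_rangeRestrict
    have := ((u.isStrictMap_isClosed_range_iff_restrict T' hT').1 ⟨hustrict, huc⟩).2
    convert this
    ext y
    simp only [mem_ran, LinearMap.mem_range]
    constructor
    · rintro ⟨f, hf⟩
      exact ⟨⟨⟨(f, y), Submodule.mem_sup_left hf⟩, hf⟩, rfl⟩
    · rintro ⟨⟨⟨⟨f, g⟩, hfg⟩, hf⟩, rfl⟩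
      exact ⟨f, hf⟩
  · rw [ran, Submodule.map_sup]
    exact Submodule.isClosed_sup_finiteDimensional _ _ h

end ClosedRange

end LinRel
open scoped ComplexConjugate InnerProductSpace

namespace LinRel

variable {H : Type*} [NormedAddCommGroup H] [InnerProductSpace ℂ H]

/-! ### Spectrum of symmetric and selfadjoint relations -/

section Symmetric

variable {S : Submodule ℂ (H × H)}

/-- Eigenvalues of a symmetric relation are real. -/
theorem conj_eq_of_mem_eigenspace (hS : S ≤ S.adjoint) {ζ : ℂ} {f : H}
    (hf : f ∈ eigenspace S ζ) (h0 : f ≠ 0) : conj ζ = ζ := by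
  have h := mem_eigenspace.1 hf
  have := mem_adjoint.1 (hS h) _ _ h
  rw [inner_smul_left, inner_smul_right] at this
  exact mul_right_cancel₀ (inner_self_ne_zero.2 h0) this

/-- Eigenvectors of a symmetric relation at different eigenvalues are orthogonal. -/
theorem inner_eq_zero_of_mem_eigenspace (hS : S ≤ S.adjoint) {ζ z : ℂ} (hne : z ≠ ζ) {f h : H}
    (hf : f ∈ eigenspace S ζ) (hh : h ∈ eigenspace S z) : ⟪f, h⟫_ℂ = 0 := by
  by_cases h0 : f = 0
  · simp [h0]
  have := mem_adjoint.1 (hS (mem_eigenspace.1 hh)) _ _ (mem_eigenspace.1 hf)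
  rw [inner_smul_left, inner_smul_right, conj_eq_of_mem_eigenspace hS hf h0] at this
  by_contra hi
  exact hne (mul_right_cancel₀ hi this).symm

variable [CompleteSpace H]

theorem IsSelfadjointRel.isClosed (hS : IsSelfadjointRel S) : IsClosed (S : Set (H × H)) := by
  have h : S.adjoint = S := hS
  exact h ▸ isClosed_adjoint S

theorem IsSelfadjointRel.le_adjoint (hS : IsSelfadjointRel S) : S ≤ S.adjoint :=
  ge_of_eq hS

/-- A spectral point of a selfadjoint relation `S` at which `S - ζ I` has closed range is an
eigenvalue. -/
theorem IsSelfadjointRel.mem_pointSpectrum (hS : IsSelfadjointRel S) {ζ : ℂ} (hζ : ζ ∈ spec S)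
    (hr : IsClosed (ran (subScalar S ζ) : Set H)) : ζ ∈ pointSpectrum S := by
  intro hbot
  have hbot' : eigenspace S (conj ζ) = ⊥ := by
    refine (Submodule.eq_bot_iff _).2 fun f hf ↦ ?_
    by_contra h0
    have := conj_eq_of_mem_eigenspace hS.le_adjoint hf h0
    rw [← this, Complex.conj_conj, hbot] at hf
    exact h0 hf
  have htop : ran (subScalar S ζ) = ⊤ := by
    have : CompleteSpace (ran (subScalar S ζ)) := hr.completeSpace_coe
    have h : S.adjoint = S := hS
    rw [← h, eigenspace_adjoint, Complex.conj_conj, Submodule.orthogonal_eq_bot_iff] at hbot'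
    exact hbot'
  obtain ⟨C, hC, h⟩ := exists_norm_le_of_isClosed_ran (isClosed_subScalar hS.isClosed ζ) hr
  refine hζ ⟨⟨C, hC, fun g f hfg ↦ h f g hfg ?_⟩, dom_inv.trans htop⟩
  have h' : ker (subScalar S ζ) = ⊥ := hbot
  rw [h', Submodule.bot_orthogonal_eq_top]
  exact Submodule.mem_top

/-- If `S - ζ I` has closed range, then `ζ` is not an accumulation point of eigenvalues of `S`. -/
theorem IsSelfadjointRel.exists_le_dist (hS : IsSelfadjointRel S) {ζ : ℂ}
    (hr : IsClosed (ran (subScalar S ζ) : Set H)) :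
    ∃ ε : ℝ, 0 < ε ∧ ∀ z ∈ pointSpectrum S, z ≠ ζ → ε ≤ dist z ζ := by
  obtain ⟨C, hC, h⟩ := exists_norm_le_of_isClosed_ran (isClosed_subScalar hS.isClosed ζ) hr
  -- An eigenvector `f` at `z` is orthogonal to `ker (S - ζ)`, whence `‖f‖ ≤ C |z - ζ| ‖f‖`.
  refine ⟨C⁻¹, by positivity, fun z hz hne ↦ ?_⟩
  obtain ⟨f, hf, h0⟩ := Submodule.exists_mem_ne_zero_of_ne_bot hz
  have hmem : (f, (z - ζ) • f) ∈ subScalar S ζ := by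
    rw [mem_subScalar, sub_smul, sub_add_cancel]
    exact mem_eigenspace.1 hf
  have hle := h _ _ hmem ((Submodule.mem_orthogonal _ _).2 fun u hu ↦
    inner_eq_zero_of_mem_eigenspace hS.le_adjoint hne hu hf)
  rw [norm_smul, ← mul_assoc] at hle
  have : 1 ≤ C * ‖z - ζ‖ := by
    by_contra! hlt
    nlinarith [norm_pos_iff.2 h0]
  rw [dist_eq_norm, inv_le_iff_one_le_mul₀ hC, mul_comm]
  exact this

end Symmetric

/-! ### Quasi-null relations and their deficiency spaces -/

section QuasiNull

variable {A : Submodule ℂ (H × H)}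

/-- The domain and the range of a quasi-null relation are orthogonal. -/
theorem IsQuasiNull.inner_eq_zero (hA : IsQuasiNull A) {f g f' g' : H} (h : (f, g) ∈ A)
    (h' : (f', g') ∈ A) : ⟪f, g'⟫_ℂ = 0 := by
  have h1 := hA _ _ (A.add_mem h h')
  have h2 := hA _ _ (A.add_mem h (A.smul_mem Complex.I h'))
  simp only [Prod.smul_mk, inner_add_left, inner_add_right,
    inner_smul_left, inner_smul_right, hA _ _ h, hA _ _ h', Complex.conj_I] at h1 h2
  have h3 : Complex.I * (⟪f, g'⟫_ℂ - ⟪f', g⟫_ℂ) = 0 := by linear_combination h2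
  have h4 := (mul_eq_zero.1 h3).resolve_left Complex.I_ne_zero
  linear_combination (h1 + h4) / 2

theorem IsQuasiNull.inner_eq_zero' (hA : IsQuasiNull A) {f g f' g' : H} (h : (f, g) ∈ A)
    (h' : (f', g') ∈ A) : ⟪g, f'⟫_ℂ = 0 :=
  inner_eq_zero_symm.1 (hA.inner_eq_zero h' h)

theorem IsQuasiNull.le_adjoint (hA : IsQuasiNull A) : A ≤ A.adjoint := by
  rintro ⟨f, g⟩ h
  exact mem_adjoint.2 fun f' g' h' ↦ by
    rw [hA.inner_eq_zero h' h, hA.inner_eq_zero' h' h]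

theorem IsQuasiNull.norm_sub_smul_sq (hA : IsQuasiNull A) {f g : H} (h : (f, g) ∈ A) (ζ : ℂ) :
    ‖g - ζ • f‖ ^ 2 = ‖g‖ ^ 2 + ‖ζ‖ ^ 2 * ‖f‖ ^ 2 := by
  rw [@norm_sub_sq ℂ, inner_smul_right, hA.inner_eq_zero' h h, norm_smul]
  simp [mul_pow]

theorem IsQuasiNull.mem_quasiRegularSet (hA : IsQuasiNull A) {ζ : ℂ} (hζ : ζ ≠ 0) :
    ζ ∈ quasiRegularSet A := by
  have hpos : 0 < ‖ζ‖ := norm_pos_iff.2 hζ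
  refine LinRel.mem_quasiRegularSet.2 ⟨‖ζ‖⁻¹, by positivity, fun f g h ↦ ?_⟩
  rw [inv_mul_eq_div, le_div_iff₀ hpos]
  refine le_of_sq_le_sq ?_ (norm_nonneg _)
  rw [hA.norm_sub_smul_sq h]
  nlinarith [sq_nonneg ‖g‖]

theorem IsQuasiNull.conj_mem_quasiRegularSet (hA : IsQuasiNull A) {ζ : ℂ}
    (hζ : ζ ∈ quasiRegularSet A) : conj ζ ∈ quasiRegularSet A := by
  by_cases h : ζ = 0
  · simpa [h] using hζ
  · exact hA.mem_quasiRegularSet (by simpa using h)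

theorem IsQuasiNull.disjoint_deficiencySpace (hA : IsQuasiNull A) {α : ℂ} (hα : α ≠ 0) :
    Disjoint A (deficiencySpace A.adjoint α) := by
  rw [Submodule.disjoint_def]
  rintro ⟨f, g⟩ h ⟨-, hg : g = α • f⟩
  subst hg
  have := hA _ _ h
  rw [inner_smul_right, mul_eq_zero, inner_self_eq_zero] at this
  simp [this.resolve_left hα]

variable [CompleteSpace H]

theorem isClosed_ran_subScalar (hcl : IsClosed (A : Set (H × H))) {ζ : ℂ}
    (hζ : ζ ∈ quasiRegularSet A) : IsClosed (ran (subScalar A ζ) : Set H) :=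
  isClosed_ran_of_isBounded_inv (isClosed_subScalar hcl ζ) hζ

theorem mem_ran_subScalar_of_orthogonal (hcl : IsClosed (A : Set (H × H))) {ζ : ℂ}
    (hζ : conj ζ ∈ quasiRegularSet A) {h : H} (hh : h ∈ (eigenspace A.adjoint ζ)ᗮ) :
    h ∈ ran (subScalar A (conj ζ)) := by
  have := (isClosed_ran_subScalar hcl hζ).completeSpace_coe
  rwa [eigenspace_adjoint, Submodule.orthogonal_orthogonal] at hh

/-- The orthogonal projection from the deficiency space at `ζ` to the one at `ζ'` is injective if
`ζ'` has a nonnegative component in the direction of `ζ`. -/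
theorem IsQuasiNull.rank_eigenspace_adjoint_le_of_re_nonneg (hA : IsQuasiNull A)
    (hcl : IsClosed (A : Set (H × H))) {ζ ζ' : ℂ} (hζ : ζ ∈ quasiRegularSet A)
    (hζ' : ζ' ∈ quasiRegularSet A) (hre : 0 ≤ (ζ' * conj ζ).re) :
    Module.rank ℂ (eigenspace A.adjoint ζ) ≤ Module.rank ℂ (eigenspace A.adjoint ζ') := by
  have : CompleteSpace (eigenspace A.adjoint ζ') := by
    rw [eigenspace_adjoint]
    exact (Submodule.isClosed_orthogonal _).completeSpace_coe
  let P := (eigenspace A.adjoint ζ').orthogonalProjectionOnto.toLinearMap ∘ₗ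
    (eigenspace A.adjoint ζ).subtype
  refine P.rank_le_of_injective ((injective_iff_map_eq_zero P).2 ?_)
  rintro ⟨h, hh⟩ hP
  have hort : h ∈ (eigenspace A.adjoint ζ')ᗮ :=
    Submodule.orthogonalProjectionOnto_eq_zero_iff.1 hP
  obtain ⟨f, g, hfg, rfl⟩ := mem_ran_subScalar.1
    (mem_ran_subScalar_of_orthogonal hcl (hA.conj_mem_quasiRegularSet hζ') hort)
  -- The vector `g - conj ζ' f` killed by `P` is tested against `g - conj ζ f`.
  rw [eigenspace_adjoint, Submodule.mem_orthogonal] at hh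
  have key := hh _ (mem_ran_subScalar.2 ⟨f, g, hfg, rfl⟩)
  simp only [inner_sub_left, inner_sub_right, inner_smul_left, inner_smul_right,
    hA.inner_eq_zero hfg hfg, hA.inner_eq_zero' hfg hfg, inner_self_eq_norm_sq_to_K,
    Complex.conj_conj, Complex.coe_algebraMap] at key
  have key' : (‖g‖ ^ 2 : ℂ) + conj ζ' * ζ * ‖f‖ ^ 2 = 0 := by linear_combination key
  have hre' : (conj ζ' * ζ).re = (ζ' * conj ζ).re := by simp
  have hsum := congrArg Complex.re key'
  rw [← Complex.ofReal_pow, ← Complex.ofReal_pow, Complex.add_re, Complex.re_mul_ofReal,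
    Complex.ofReal_re, hre', Complex.zero_re] at hsum
  have hg : g = 0 := by
    have : ‖g‖ ^ 2 ≤ 0 := by nlinarith [mul_nonneg hre (sq_nonneg ‖f‖)]
    exact norm_eq_zero.1 (pow_eq_zero_iff two_ne_zero |>.1 (le_antisymm this (sq_nonneg _)))
  subst hg
  have hz : conj ζ' • f = 0 := by
    -- For `ζ = 0` the identity `key'` says nothing about `f`, but quasi-regularity of `0` forces `f
    -- = 0`.
    rcases eq_or_ne ζ 0 with rfl | h0
    · obtain ⟨C, -, hC⟩ := LinRel.mem_quasiRegularSet.1 hζ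
      have := hC _ _ hfg
      simp only [zero_smul, sub_zero, norm_zero, mul_zero, norm_le_zero_iff] at this
      simp [this]
    · simpa [h0] using key'
  ext
  simp [hz]

/-- The dimension of the deficiency spaces is constant on the quasi-regular set. -/
theorem IsQuasiNull.rank_eigenspace_adjoint_le (hA : IsQuasiNull A)
    (hcl : IsClosed (A : Set (H × H))) {ζ ζ' : ℂ} (hζ : ζ ∈ quasiRegularSet A)
    (hζ' : ζ' ∈ quasiRegularSet A) :
    Module.rank ℂ (eigenspace A.adjoint ζ) ≤ Module.rank ℂ (eigenspace A.adjoint ζ') := by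
  have via (μ : ℂ) (hμ : μ ≠ 0) (h : 0 ≤ (μ * conj ζ).re) (h' : 0 ≤ (ζ' * conj μ).re) :
      Module.rank ℂ (eigenspace A.adjoint ζ) ≤ Module.rank ℂ (eigenspace A.adjoint ζ') :=
    (hA.rank_eigenspace_adjoint_le_of_re_nonneg hcl hζ (hA.mem_quasiRegularSet hμ) h).trans
      (hA.rank_eigenspace_adjoint_le_of_re_nonneg hcl (hA.mem_quasiRegularSet hμ) hζ' h')
  by_cases h0 : ζ = 0
  · exact hA.rank_eigenspace_adjoint_le_of_re_nonneg hcl hζ hζ' (by simp [h0])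
  -- Both `±iζ` are perpendicular to `ζ`, and one of them has a nonnegative component along `ζ'`.
  rcases le_total 0 (ζ' * conj (Complex.I * ζ)).re with h | h
  · refine via (Complex.I * ζ) (mul_ne_zero Complex.I_ne_zero h0) ?_ h
    simp only [Complex.mul_re, Complex.mul_im, Complex.conj_re, Complex.conj_im, Complex.I_re,
      Complex.I_im]
    exact le_of_eq (by ring)
  · refine via (-(Complex.I * ζ)) (neg_ne_zero.2 (mul_ne_zero Complex.I_ne_zero h0)) ?_ ?_
    · simp only [Complex.mul_re, Complex.mul_im, Complex.conj_re, Complex.conj_im, Complex.I_re,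
        Complex.I_im, Complex.neg_re, Complex.neg_im]
      exact le_of_eq (by ring)
    · simpa using h

theorem IsQuasiNull.rank_eigenspace_adjoint_eq (hA : IsQuasiNull A)
    (hcl : IsClosed (A : Set (H × H))) {ζ ζ' : ℂ} (hζ : ζ ∈ quasiRegularSet A)
    (hζ' : ζ' ∈ quasiRegularSet A) :
    Module.rank ℂ (eigenspace A.adjoint ζ) = Module.rank ℂ (eigenspace A.adjoint ζ') :=
  (hA.rank_eigenspace_adjoint_le hcl hζ hζ').antisymm (hA.rank_eigenspace_adjoint_le hcl hζ' hζ)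

/-! ### The extension `S_α` -/

theorem mem_extensionAt {α : ℂ} {p : H × H} :
    p ∈ extensionAt A α ↔
      ∃ f g n, (f, g) ∈ A ∧ n ∈ eigenspace A.adjoint α ∧ p = (f + n, g + α • n) := by
  constructor
  · intro h
    obtain ⟨⟨f, g⟩, hfg, ⟨n, m⟩, ⟨hn, hm : m = α • n⟩, rfl⟩ := Submodule.mem_sup.1 h
    subst hm
    exact ⟨f, g, n, hfg, mem_eigenspace.2 hn, rfl⟩
  · rintro ⟨f, g, n, hfg, hn, rfl⟩
    exact Submodule.mem_sup.2 ⟨_, hfg, _, ⟨mem_eigenspace.1 hn, rfl⟩, rfl⟩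

theorem IsQuasiNull.isSelfadjointRel_extensionAt (hA : IsQuasiNull A)
    (hcl : IsClosed (A : Set (H × H))) {α : ℝ} (hα : α ≠ 0) :
    IsSelfadjointRel (extensionAt A α) := by
  have hα' : (α : ℂ) ≠ 0 := by exact_mod_cast hα
  have hsymm : extensionAt A α ≤ (extensionAt A α).adjoint := by
    intro p hp
    obtain ⟨f, g, n, hfg, hn, rfl⟩ := mem_extensionAt.1 hp
    refine mem_adjoint.2 fun x y hxy ↦ ?_
    obtain ⟨f', g', n', hfg', hn', e⟩ := mem_extensionAt.1 hxy
    obtain ⟨rfl, rfl⟩ := Prod.mk.inj e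
    have e1 := mem_adjoint.1 (mem_eigenspace.1 hn) _ _ hfg'
    have e2 := congrArg conj (mem_adjoint.1 (mem_eigenspace.1 hn') _ _ hfg)
    rw [inner_conj_symm, inner_conj_symm, inner_smul_left] at e2
    rw [inner_smul_right] at e1
    simp only [inner_add_left, inner_add_right, inner_smul_left, inner_smul_right,
      hA.inner_eq_zero hfg' hfg, hA.inner_eq_zero' hfg' hfg, Complex.conj_ofReal] at e2 ⊢
    linear_combination e1 - e2
  refine le_antisymm ?_ hsymm
  rintro ⟨h, k⟩ hhk
  have hcr := isClosed_ran_subScalar hcl (hA.mem_quasiRegularSet hα')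
  have : CompleteSpace (ran (subScalar A α)) := hcr.completeSpace_coe
  obtain ⟨y, hy, n, hn, e⟩ :=
    (ran (subScalar A α)).exists_add_mem_mem_orthogonal (k - (α : ℂ) • h)
  obtain ⟨f, g, hfg, rfl⟩ := mem_ran_subScalar.1 hy
  have hn' : n ∈ eigenspace A.adjoint α := by
    rwa [eigenspace_adjoint, Complex.conj_ofReal]
  have hsub : (h - f, k - g) ∈ (extensionAt A α).adjoint :=
    Submodule.sub_mem _ hhk (hsymm (Submodule.mem_sup_left hfg))
  have hk : k - g = (α : ℂ) • (h - f) + n := by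
    have : k = g - (α : ℂ) • f + n + (α : ℂ) • h := by rw [← e]; abel
    rw [this, smul_sub]
    abel
  -- The pair `(h - f, α (h - f) + n)` lies in the adjoint of `S_α`; pairing it with `(n, α n)`
  -- leaves `⟨n, n⟩ = 0`.
  have hn0 : n = 0 := by
    have := mem_adjoint.1 hsub n ((α : ℂ) • n)
      (Submodule.mem_sup_right ⟨mem_eigenspace.1 hn', rfl⟩)
    rw [hk, inner_add_right, inner_smul_left, inner_smul_right, Complex.conj_ofReal] at this
    exact inner_self_eq_zero.1 (by linear_combination -this)
  refine mem_extensionAt.2 ⟨f, g, h - f, hfg, ?_, ?_⟩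
  · rw [mem_eigenspace]
    have := adjoint_anti (le_sup_left : A ≤ extensionAt A α) hsub
    rwa [hk, hn0, add_zero] at this
  · rw [hn0, add_zero] at hk
    rw [← hk]
    simp

theorem IsQuasiNull.eigenspace_extensionAt_self (hA : IsQuasiNull A) {α : ℂ} (hα : α ≠ 0) :
    eigenspace (extensionAt A α) α = eigenspace A.adjoint α := by
  ext h
  constructor
  · intro hh
    obtain ⟨f, g, n, hfg, hn, e⟩ := mem_extensionAt.1 (mem_eigenspace.1 hh)
    obtain ⟨rfl, e⟩ := Prod.mk.inj e
    rw [smul_add, add_left_inj] at e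
    subst e
    have := hA _ _ hfg
    rw [inner_smul_right, mul_eq_zero, inner_self_eq_zero] at this
    rwa [this.resolve_left hα, zero_add]
  · intro hh
    exact mem_eigenspace.2 (Submodule.mem_sup_right ⟨mem_eigenspace.1 hh, rfl⟩)

/-- As `S ≤ A*`, equal finite dimensions make the two eigenspaces coincide, so `S` contains `S_α`;
taking adjoints reverses the inclusion. -/
theorem eq_extensionAt {α : ℂ} (hself : IsSelfadjointRel (extensionAt A α))
    [FiniteDimensional ℂ (eigenspace A.adjoint α)] {S : Submodule ℂ (H × H)} (hAS : A ≤ S)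
    (hS : IsSelfadjointRel S)
    (hr : Module.rank ℂ (eigenspace S α) = Module.rank ℂ (eigenspace A.adjoint α)) :
    S = extensionAt A α := by
  have h1 : S.adjoint = S := hS
  have h2 : (extensionAt A α).adjoint = extensionAt A α := hself
  have hle : eigenspace S α ≤ eigenspace A.adjoint α :=
    eigenspace_mono (h1 ▸ adjoint_anti hAS) α
  have heq : eigenspace S α = eigenspace A.adjoint α :=
    Submodule.eq_of_le_of_finrank_eq hle (by rw [Module.finrank, hr, Module.finrank])
  have hext : extensionAt A α ≤ S := by
    refine sup_le hAS ?_
    rintro ⟨f, g⟩ ⟨hf, rfl : g = α • f⟩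
    have := mem_eigenspace.2 hf
    rw [← heq] at this
    exact mem_eigenspace.1 this
  refine le_antisymm ?_ hext
  calc S = S.adjoint := h1.symm
    _ ≤ (extensionAt A α).adjoint := adjoint_anti hext
    _ = extensionAt A α := h2

theorem IsQuasiNull.inner_extensionAt (hA : IsQuasiNull A) {α : ℝ} {x y : H}
    (hxy : (x, y) ∈ extensionAt A α) :
    ∃ f : H, ⟪x, y⟫_ℂ = ((α * (‖x‖ ^ 2 - ‖f‖ ^ 2) : ℝ) : ℂ) := by
  obtain ⟨f, g, n, hfg, hn, e⟩ := mem_extensionAt.1 hxy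
  obtain ⟨rfl, rfl⟩ := Prod.mk.inj e
  refine ⟨f, ?_⟩
  have e1 := congrArg conj (mem_adjoint.1 (mem_eigenspace.1 hn) _ _ hfg)
  rw [inner_conj_symm, inner_conj_symm, inner_smul_left, Complex.conj_ofReal] at e1
  have hx : ((‖f + n‖ ^ 2 : ℝ) : ℂ) = ⟪f + n, f + n⟫_ℂ := by
    rw [inner_self_eq_norm_sq_to_K]
    simp
  have hf : ((‖f‖ ^ 2 : ℝ) : ℂ) = ⟪f, f⟫_ℂ := by
    rw [inner_self_eq_norm_sq_to_K]
    simp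
  rw [Complex.ofReal_mul, Complex.ofReal_sub, hx, hf]
  simp only [inner_add_left, inner_add_right, inner_smul_right, hA _ _ hfg]
  linear_combination e1

theorem IsQuasiNull.isLowerSemibounded_extensionAt (hA : IsQuasiNull A) {α : ℝ} (hα : α < 0) :
    IsLowerSemibounded (extensionAt A α) := by
  refine ⟨α, fun x y hxy ↦ ?_⟩
  obtain ⟨f, hf⟩ := hA.inner_extensionAt hxy
  rw [hf, Complex.ofReal_im, Complex.ofReal_re]
  exact ⟨rfl, by nlinarith [sq_nonneg ‖f‖]⟩

theorem IsQuasiNull.isUpperSemibounded_extensionAt (hA : IsQuasiNull A) {α : ℝ} (hα : 0 < α) :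
    IsUpperSemibounded (extensionAt A α) := by
  refine ⟨-α, fun x y hxy ↦ ?_⟩
  obtain ⟨x, z, hxz, e⟩ := hxy
  obtain ⟨rfl, rfl⟩ := Prod.mk.inj e
  obtain ⟨f, hf⟩ := hA.inner_extensionAt hxz
  rw [inner_neg_right, hf, Complex.neg_im, Complex.neg_re, Complex.ofReal_im, Complex.ofReal_re]
  exact ⟨neg_zero, by nlinarith [sq_nonneg ‖f‖]⟩

theorem isClosed_ran_subScalar_extensionAt_iff (hcl : IsClosed (A : Set (H × H))) {α : ℂ}
    [FiniteDimensional ℂ (eigenspace A.adjoint α)] (ζ : ℂ) :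
    IsClosed (ran (subScalar (extensionAt A α) ζ) : Set H) ↔
      IsClosed (ran (subScalar A ζ) : Set H) := by
  have := finiteDimensional_deficiencySpace A.adjoint α
  have hfin : FiniteDimensional ℂ (subScalar (deficiencySpace A.adjoint α) ζ) := by
    rw [subScalar_eq_map]
    infer_instance
  rw [extensionAt, subScalar_sup]
  exact isClosed_ran_sup_iff (isClosed_subScalar hcl ζ) _

theorem IsQuasiNull.isClosed_ran_subScalar_extensionAt (hA : IsQuasiNull A)
    (hcl : IsClosed (A : Set (H × H))) {α ζ : ℂ} [FiniteDimensional ℂ (eigenspace A.adjoint α)]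
    (hζ : ζ ≠ 0) : IsClosed (ran (subScalar (extensionAt A α) ζ) : Set H) :=
  (isClosed_ran_subScalar_extensionAt_iff hcl ζ).2
    (isClosed_ran_subScalar hcl (hA.mem_quasiRegularSet hζ))

theorem IsQuasiNull.eigenspace_extensionAt_le (hA : IsQuasiNull A)
    (hcl : IsClosed (A : Set (H × H))) {α : ℝ} (hα : α ≠ 0) (ζ : ℂ) :
    eigenspace (extensionAt A α) ζ ≤ eigenspace A.adjoint ζ :=
  eigenspace_mono ((hA.isSelfadjointRel_extensionAt hcl hα).le_adjoint.trans
    (adjoint_anti le_sup_left)) ζ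

theorem zero_mem_essentialSpectrum_extensionAt_iff (hcl : IsClosed (A : Set (H × H))) {α : ℂ}
    [FiniteDimensional ℂ (eigenspace A.adjoint α)] :
    0 ∈ essentialSpectrum (extensionAt A α) ↔ 0 ∈ essentialSpectrum A := by
  have := finiteDimensional_deficiencySpace A.adjoint α
  rw [mem_essentialSpectrum, mem_essentialSpectrum, isClosed_ran_subScalar_extensionAt_iff hcl,
    eigenspace, eigenspace, subScalar_zero, subScalar_zero, extensionAt,
    finiteDimensional_ker_sup_iff]

end QuasiNull

end LinRel

/-! ### The main theorem -/

theorem mainTheorem9 {H : Type*} [NormedAddCommGroup H] [InnerProductSpace ℂ H] [CompleteSpace H]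
    (A : Submodule ℂ (H × H)) (hclosed : IsClosed (A : Set (H × H))) (hA : LinRel.IsQuasiNull A)
    (ζ₀ : ℂ) (hζ₀ : ζ₀ ∈ LinRel.quasiRegularSet A)
    (η : ℕ) (hη : Module.rank ℂ (LinRel.deficiencySpace A.adjoint ζ₀) = η) :
    (∀ α : ℝ, α ≠ 0 →
      -- the sum defining `S_α` is direct
      Disjoint A (LinRel.deficiencySpace A.adjoint α) ∧
      -- `S_α` is a selfadjoint extension with eigenvalue `α` of multiplicity `η`, and the only one
      (∀ S : Submodule ℂ (H × H),
        (A ≤ S ∧ LinRel.IsSelfadjointRel S ∧ Module.rank ℂ (LinRel.eigenspace S α) = η) ↔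
          S = LinRel.extensionAt A α) ∧
      -- nonzero spectral points are isolated eigenvalues of multiplicity at most `η`
      (∀ ζ ∈ LinRel.spec (LinRel.extensionAt A α), ζ ≠ 0 →
        (∃ ε : ℝ, 0 < ε ∧ ∀ z ∈ LinRel.spec (LinRel.extensionAt A α), z ≠ ζ → ε ≤ dist z ζ) ∧
        ζ ∈ LinRel.pointSpectrum (LinRel.extensionAt A α) ∧
        Module.rank ℂ (LinRel.eigenspace (LinRel.extensionAt A α) ζ) ≤ η) ∧
      LinRel.essentialSpectrum (LinRel.extensionAt A α) ⊆ {0} ∧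
      (α < 0 → LinRel.IsLowerSemibounded (LinRel.extensionAt A α)) ∧
      (0 < α → LinRel.IsUpperSemibounded (LinRel.extensionAt A α))) ∧
    -- all the `S_α` have the same essential spectrum
    (∀ α β : ℝ, α ≠ 0 → β ≠ 0 →
      LinRel.essentialSpectrum (LinRel.extensionAt A α) =
        LinRel.essentialSpectrum (LinRel.extensionAt A β)) := by
  have hη' : Module.rank ℂ (LinRel.eigenspace A.adjoint ζ₀) = η := by
    rw [← LinRel.rank_deficiencySpace, hη]
  have hrank (ζ : ℂ) (hζ : ζ ≠ 0) : Module.rank ℂ (LinRel.eigenspace A.adjoint ζ) = η :=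
    (hA.rank_eigenspace_adjoint_eq hclosed (hA.mem_quasiRegularSet hζ) hζ₀).trans hη'
  have hfin (ζ : ℂ) (hζ : ζ ≠ 0) : FiniteDimensional ℂ (LinRel.eigenspace A.adjoint ζ) :=
    Module.rank_lt_aleph0_iff.1 (hrank ζ hζ ▸ Cardinal.natCast_lt_aleph0)
  have hess (α : ℝ) (hα : α ≠ 0) : LinRel.essentialSpectrum (LinRel.extensionAt A α) ⊆ {0} := by
    intro ζ hζ
    by_contra hne
    have := hfin ζ hne
    have := hfin α (Complex.ofReal_ne_zero.2 hα)
    refine LinRel.mem_essentialSpectrum.1 hζ ⟨?_, ?_⟩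
    · exact Submodule.finiteDimensional_of_le (hA.eigenspace_extensionAt_le hclosed hα ζ)
    · exact hA.isClosed_ran_subScalar_extensionAt hclosed hne
  refine ⟨fun α hα ↦ ?_, fun α β hα hβ ↦ ?_⟩
  · have hα' : (α : ℂ) ≠ 0 := Complex.ofReal_ne_zero.2 hα
    have hself := hA.isSelfadjointRel_extensionAt hclosed hα
    have := hfin α hα'
    refine ⟨hA.disjoint_deficiencySpace hα', fun S ↦ ⟨?_, ?_⟩, fun ζ hζ hne ↦ ?_, hess α hα,
      hA.isLowerSemibounded_extensionAt, hA.isUpperSemibounded_extensionAt⟩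
    · rintro ⟨hAS, hS, hr⟩
      exact LinRel.eq_extensionAt hself hAS hS (hr.trans (hrank α hα').symm)
    · rintro rfl
      exact ⟨le_sup_left, hself, by rw [hA.eigenspace_extensionAt_self hα', hrank α hα']⟩
    · have hcr (z : ℂ) (hz : z ≠ 0) := hA.isClosed_ran_subScalar_extensionAt (α := α) hclosed hz
      obtain ⟨ε, hε, h⟩ := hself.exists_le_dist (hcr ζ hne)
      -- `ε` keeps only eigenvalues away; `0` may be spectral without being one, hence the bound
      -- `‖ζ‖`.
      refine ⟨⟨min ε ‖ζ‖, lt_min hε (norm_pos_iff.2 hne), fun z hz hzζ ↦ ?_⟩,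
        hself.mem_pointSpectrum hζ (hcr ζ hne), ?_⟩
      · rcases eq_or_ne z 0 with rfl | hz0
        · rw [dist_zero_left]
          exact min_le_right _ _
        · exact (min_le_left _ _).trans (h z (hself.mem_pointSpectrum hz (hcr z hz0)) hzζ)
      · exact (Submodule.rank_mono (hA.eigenspace_extensionAt_le hclosed hα ζ)).trans
          (hrank ζ hne).le
  · have := hfin α (Complex.ofReal_ne_zero.2 hα)
    have := hfin β (Complex.ofReal_ne_zero.2 hβ)
    ext ζ
    rcases eq_or_ne ζ 0 with rfl | hne
    · rw [LinRel.zero_mem_essentialSpectrum_extensionAt_iff hclosed,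
        LinRel.zero_mem_essentialSpectrum_extensionAt_iff hclosed]
    · exact iff_of_false (fun h ↦ hne (hess α hα h)) fun h ↦ hne (hess β hβ h)
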